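/- **Theorem 4.2.** Consider the repeated hidden-action principal–agent problem with a single agent type, two outcomes $0$ (the null outcome) and $1$, and principal value vector $v=(0,1)$. An instance $i$ consists of a set of actions $\mathcal A$ (finite or infinite), for every action $a\in\mathcal A$ a distribution $p(\cdot\mid a)$ on $\{0,1\}$ and a cost $c(a)\in[0,1]$, and a null action with cost $0$ that leads to outcome $0$ with probability one; it is assumed that for every contract $f\in[0,1]^2$ the agent's expected utility $\sum_o p(o\mid a)f_o-c(a)$ attains its maximum over $a\in\mathcal A$. The principal is restricted to the linear contracts $\alpha v=(0,\alpha)$, $\alpha\in[0,1]$. To such a contract the agent responds with an action $a^\star(\alpha)$ that maximizes $\alpha\,p(1\mid a)-c(a)$, and the principal's expected utility is $u_i(\alpha)=(1-\alpha)\,p(1\mid a^\star(\alpha))$. In each round $t=1,\dots,T$ the principal draws $\alpha^{(t)}\in[0,1]$ from a distribution which is determined by a policy $\pi$ (not knowing the instance) and the history $(\alpha^{(1)},o^{(1)},\dots,\alpha^{(t-1)},o^{(t-1)})$, and then observes an outcome $o^{(t)}\sim p(\cdot\mid a^\star(\alpha^{(t)}))$. There is a universal constant $C>0$ such that for every horizon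 $T$ and every policy $\pi$ (which may depend on $T$) there is an instance $i$ for which, however the agent breaks ties among best responses (by a fixed map $\alpha\mapsto a^\star(\alpha)$), $$\sup_{\alpha\in[0,1]}\ \sum_{t=1}^T\mathbb E\big[u_i(\alpha)-u_i(\alpha^{(t)})\big]\ \ge\ C\,T^{2/3}.$$ In particular $\inf_\pi\sup_i R_T(\pi)\ge C\,T^{2/3}$, where $R_T(\pi)$ is the regret on the left-hand side. -/

import Mathlib

open MeasureTheory ProbabilityTheory

noncomputable section

namespace OnlineContract

/-- A hidden-action problem instance with a single agent type and the `m` outcomes `0, …, m - 1`,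
outcome `0` being the null outcome. The action set may be finite or infinite. The principal's value
vector is known and fixed, and is therefore not part of this structure. -/
structure SingleTypeInstance (m : ℕ) [NeZero m] where
  /-- the set of actions of the agent -/
  Action : Type
  /-- the production function: `prod a` is the distribution of the outcome under action `a` -/
  prod : Action → PMF (Fin m)
  /-- the cost of each action -/
  cost : Action → ℝ
  cost_nonneg : ∀ a, 0 ≤ cost a
  cost_le_one : ∀ a, cost a ≤ 1
  /-- the null action: it is free and leads to the null outcome for sure -/
  null : Action
  prod_null : prod null = PMF.pure 0
  cost_null : cost null = 0
  /-- the agent's maximization problem has a solution for every contract in `[0, 1]^m` -/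
  exists_argmax : ∀ f : Fin m → ℝ, (∀ o, f o ∈ Set.Icc (0 : ℝ) 1) →
    ∃ a, ∀ b, (∑ o, (prod b o).toReal * f o) - cost b ≤ (∑ o, (prod a o).toReal * f o) - cost a

namespace SingleTypeInstance

variable {m : ℕ} [NeZero m]

/-- The agent's expected utility: expected payment minus cost. -/
def agentUtility (I : SingleTypeInstance m) (f : Fin m → ℝ) (a : I.Action) : ℝ :=
  (∑ o, (I.prod a o).toReal * f o) - I.cost a

/-- The principal's expected utility when the agent takes action `a` under contract `f`. -/
def principalUtility (I : SingleTypeInstance m) (v f : Fin m → ℝ) (a : I.Action) : ℝ :=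
  ∑ o, (I.prod a o).toReal * (v o - f o)

end SingleTypeInstance

/-- The linear contract `α · v`. -/
def linearContract {m : ℕ} (v : Fin m → ℝ) (α : unitInterval) : Fin m → ℝ :=
  fun o => (α : ℝ) * v o

/-- A best-response map `a⋆` of the agent on the linear contracts `α · v`, `α ∈ [0, 1]`: a choice of
a maximizer of the agent's utility for each such contract, ties being broken arbitrarily. -/
structure BestResponse {m : ℕ} [NeZero m] (I : SingleTypeInstance m) (v : Fin m → ℝ) where
  act : unitInterval → I.Action
  isBest : ∀ (α : unitInterval) (b : I.Action),
    I.agentUtility (linearContract v α) b ≤ I.agentUtility (linearContract v α) (act α)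

/-- The principal's expected utility `u(α)` from the linear contract `α · v`. -/
def utility {m : ℕ} [NeZero m] {I : SingleTypeInstance m} {v : Fin m → ℝ}
    (br : BestResponse I v) (α : unitInterval) : ℝ :=
  I.principalUtility v (linearContract v α) (br.act α)

/-- The principal's value vector `(0, 1)` for two outcomes. -/
def value01 : Fin 2 → ℝ := ![0, 1]

/-- Under best responses the probability of the non-null outcome is nondecreasing in `α`. -/
theorem prod_one_monotone {I : SingleTypeInstance 2} (br : BestResponse I value01) :
    Monotone fun α => (I.prod (br.act α) 1).toReal := by
  intro α β hαβ
  rcases hαβ.eq_or_lt with rfl | hlt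
  · exact le_rfl
  have h1 := br.isBest α (br.act β)
  have h2 := br.isBest β (br.act α)
  simp only [SingleTypeInstance.agentUtility, linearContract, value01, Fin.sum_univ_two,
    Matrix.cons_val_zero, Matrix.cons_val_one, mul_zero, zero_add, mul_one] at h1 h2
  have hlt' : (α : ℝ) < β := hlt
  by_contra hcon
  simp only [not_le] at hcon
  nlinarith

/-- The outcome distribution depends measurably on `α`. -/
theorem measurable_outcome {I : SingleTypeInstance 2} (br : BestResponse I value01) :
    Measurable fun α => (I.prod (br.act α)).toMeasure := by
  have h1 : Measurable fun α => I.prod (br.act α) 1 := by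
    have h := (prod_one_monotone br).measurable.ennreal_ofReal
    simpa only [ENNReal.ofReal_toReal (PMF.apply_ne_top _ _)] using h
  have h0 : Measurable fun α => I.prod (br.act α) 0 := by
    have h : ∀ α, I.prod (br.act α) 0 = 1 - I.prod (br.act α) 1 := by
      intro α
      have hs : I.prod (br.act α) 0 + I.prod (br.act α) 1 = 1 := by
        have := (I.prod (br.act α)).tsum_coe
        rwa [tsum_fintype, Fin.sum_univ_two] at this
      exact ENNReal.eq_sub_of_add_eq (PMF.apply_ne_top _ _) hs
    simp only [h]
    exact measurable_const.sub h1
  refine Measure.measurable_of_measurable_coe _ fun s _ => ?_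
  have hs : ∀ α, (I.prod (br.act α)).toMeasure s
      = s.indicator (fun _ => I.prod (br.act α) 0) 0
        + s.indicator (fun _ => I.prod (br.act α) 1) 1 := by
    intro α
    rw [PMF.toMeasure_apply_fintype, Fin.sum_univ_two]
    simp only [Set.indicator]
  simp only [hs]
  refine Measurable.add ?_ ?_
  · by_cases h : (0 : Fin 2) ∈ s <;> simp [h, h0]
  · by_cases h : (1 : Fin 2) ∈ s <;> simp [h, h1]

/-- The law of the observed outcome when the contract `α · (0, 1)` is proposed. -/
def outcomeKernel {I : SingleTypeInstance 2} (br : BestResponse I value01) :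
    Kernel unitInterval (Fin 2) where
  toFun α := (I.prod (br.act α)).toMeasure
  measurable' := measurable_outcome br

instance {I : SingleTypeInstance 2} (br : BestResponse I value01) :
    IsMarkovKernel (outcomeKernel br) :=
  ⟨fun α => PMF.toMeasure.isProbabilityMeasure (I.prod (br.act α))⟩

/-- Histories `(α₁, o₁, …, α_t, o_t)` of proposed linear contracts and observed outcomes. -/
abbrev History (t : ℕ) : Type := Fin t → unitInterval × Fin 2

/-- A randomized history-dependent policy over linear contracts: after `t` rounds, the next
parameter `α` is drawn from a distribution that depends on the history of these rounds. -/
structure Policy where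
  next : (t : ℕ) → Kernel (History t) unitInterval
  isMarkov : ∀ t, IsMarkovKernel (next t)

/-- The law of the history of the first `t` rounds: in every round `α` is drawn by the policy given
the past, and then the outcome is drawn from the agent's best-response distribution at `α`. -/
def historyLaw {I : SingleTypeInstance 2} (br : BestResponse I value01) (π : Policy) :
    (t : ℕ) → Measure (History t)
  | 0 => Measure.dirac (fun i => i.elim0)
  | t + 1 =>
      (historyLaw br π t ⊗ₘ (π.next t ⊗ₖ Kernel.prodMkLeft (History t) (outcomeKernel br))).map
        (fun x => Fin.snoc (α := fun _ => unitInterval × Fin 2) x.1 x.2)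

/-- The Stackelberg regret `sup_α ∑_{t ≤ T} 𝔼[u(α) - u(α_t)]` over the linear contracts. -/
def regret {I : SingleTypeInstance 2} (br : BestResponse I value01) (π : Policy) (T : ℕ) : ℝ :=
  ⨆ α : unitInterval, ∑ t : Fin T,
    ∫ h : History T, (utility br α - utility br (h t).1) ∂(historyLaw br π T)

end OnlineContract

end

open MeasureTheory ProbabilityTheory

noncomputable section

namespace OnlineContract

/-! Let the agent choose a success probability `q ∈ [0, 3/4]` at cost `effortCost q`. Its marginal
cost for `q ≥ 1/2` is `1 - 1/(4q)`, so the contracts inducing such `q` all pay the principal `1/4`,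
and no contract pays more (`exists_unique_effort`). Deleting an interval `(a, b)` of success
probabilities, with `1/2 ≤ a < b ≤ 3/4`, changes the response only at the contracts that used to
induce a `q` in `(a, b)`; call them the window. Inside it the agent jumps from `a` to `b` at a
contract cheaper than the one formerly needed for `b`, so some contract now pays `1/4` plus order `b
- a` (`exists_gap_utility_ge`), while outside the window `1/4` remains the cap (`gap_utility_le`).

Place order `n` disjoint windows of width `D` of order `1/n`. Under the instance without a gap, some
window receives at most a `1/(40n)` share of the rounds. Each visit reveals relative entropy at most
`6 D²`, so when `T ≤ n³` the policy barely distinguishes this instance from the one with that gap,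
and it rarely visits the window there either (`integral_visits_le`). The rounds outside the window
then lose order `D` each, and `n` of order `T^(1/3)` yields regret of order `T D`, that is
`T^(2/3)`. -/

instance (π : Policy) (t : ℕ) : IsMarkovKernel (π.next t) := π.isMarkov t

/-- The probability of the non-null outcome under the best response to `α`. -/
def successProb {I : SingleTypeInstance 2} (br : BestResponse I value01) (α : unitInterval) : ℝ :=
  (I.prod (br.act α) 1).toReal

/-! ### Utilities and outcome laws in terms of the success probability -/

section SuccessProb

variable {I : SingleTypeInstance 2} (br : BestResponse I value01)

lemma SingleTypeInstance.prod_zero_toReal (I : SingleTypeInstance 2) (a : I.Action) :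
    (I.prod a 0).toReal = 1 - (I.prod a 1).toReal := by
  have hs : I.prod a 0 + I.prod a 1 = 1 := by
    have := (I.prod a).tsum_coe
    rwa [tsum_fintype, Fin.sum_univ_two] at this
  have := congrArg ENNReal.toReal hs
  rw [ENNReal.toReal_add (PMF.apply_ne_top _ _) (PMF.apply_ne_top _ _), ENNReal.toReal_one] at this
  linarith

lemma successProb_nonneg (α : unitInterval) : 0 ≤ successProb br α := ENNReal.toReal_nonneg

lemma successProb_le_one (α : unitInterval) : successProb br α ≤ 1 := by
  have h := I.prod_zero_toReal (br.act α)
  have h0 : 0 ≤ (I.prod (br.act α) 0).toReal := ENNReal.toReal_nonneg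
  unfold successProb
  linarith

lemma successProb_monotone : Monotone (successProb br) := prod_one_monotone br

lemma measurable_successProb : Measurable (successProb br) := (successProb_monotone br).measurable

lemma utility_eq (α : unitInterval) : utility br α = (1 - (α : ℝ)) * successProb br α := by
  simp [utility, SingleTypeInstance.principalUtility, linearContract, value01, successProb,
    Fin.sum_univ_two]
  ring

lemma measurable_utility : Measurable (utility br) := by
  have : utility br = fun α : unitInterval => (1 - (α : ℝ)) * successProb br α :=
    funext (utility_eq br)
  rw [this]
  exact (measurable_const.sub measurable_subtype_coe).mul (measurable_successProb br)

lemma utility_nonneg (α : unitInterval) : 0 ≤ utility br α := by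
  rw [utility_eq]
  exact mul_nonneg (by linarith [α.2.2]) (successProb_nonneg br α)

lemma utility_le_one (α : unitInterval) : utility br α ≤ 1 := by
  rw [utility_eq]
  exact mul_le_one₀ (by linarith [α.2.1]) (successProb_nonneg br α) (successProb_le_one br α)

lemma outcomeKernel_one (α : unitInterval) :
    outcomeKernel br α {1} = ENNReal.ofReal (successProb br α) := by
  change (I.prod (br.act α)).toMeasure {1} = _
  rw [PMF.toMeasure_apply_singleton _ _ (MeasurableSet.singleton _), successProb,
    ENNReal.ofReal_toReal (PMF.apply_ne_top _ _)]

lemma outcomeKernel_zero (α : unitInterval) :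
    outcomeKernel br α {0} = ENNReal.ofReal (1 - successProb br α) := by
  change (I.prod (br.act α)).toMeasure {0} = _
  rw [PMF.toMeasure_apply_singleton _ _ (MeasurableSet.singleton _), successProb,
    ← I.prod_zero_toReal, ENNReal.ofReal_toReal (PMF.apply_ne_top _ _)]

end SuccessProb

/-! ### Integration against the history law and change of measure -/

section HistoryLaw

variable {I : SingleTypeInstance 2} (br : BestResponse I value01) (π : Policy)

lemma measurable_history_snoc (t : ℕ) :
    Measurable fun x : History t × (unitInterval × Fin 2) =>
      (Fin.snoc (α := fun _ => unitInterval × Fin 2) x.1 x.2 : History (t + 1)) := by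
  refine measurable_pi_iff.2 fun i => ?_
  induction i using Fin.lastCases with
  | last => simpa using measurable_snd
  | cast j =>
    simp only [Fin.snoc_castSucc]
    exact (measurable_pi_apply j).comp measurable_fst

instance isProbabilityMeasure_historyLaw (t : ℕ) : IsProbabilityMeasure (historyLaw br π t) := by
  induction t with
  | zero => exact Measure.dirac.isProbabilityMeasure
  | succ t ih =>
    exact Measure.isProbabilityMeasure_map (measurable_history_snoc t).aemeasurable

lemma lintegral_historyLaw_succ (t : ℕ) {F : History (t + 1) → ENNReal} (hF : Measurable F) :
    ∫⁻ h, F h ∂historyLaw br π (t + 1) =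
      ∫⁻ h, ∫⁻ α, ∫⁻ o, F (Fin.snoc (α := fun _ => unitInterval × Fin 2) h (α, o))
        ∂outcomeKernel br α ∂π.next t h ∂historyLaw br π t := by
  have hG : Measurable fun x : History t × (unitInterval × Fin 2) =>
      F (Fin.snoc (α := fun _ => unitInterval × Fin 2) x.1 x.2) :=
    hF.comp (measurable_history_snoc t)
  rw [historyLaw, lintegral_map hF (measurable_history_snoc t), Measure.lintegral_compProd hG]
  refine lintegral_congr fun h => ?_
  exact Kernel.lintegral_compProd _ _ _ (hG.comp measurable_prodMk_left)

lemma integral_historyLaw_succ (t : ℕ) {F : History (t + 1) → ℝ}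
    (hF : Integrable F (historyLaw br π (t + 1))) :
    ∫ h, F h ∂historyLaw br π (t + 1) =
      ∫ h, ∫ x, F (Fin.snoc (α := fun _ => unitInterval × Fin 2) h x)
        ∂((π.next t ⊗ₖ Kernel.prodMkLeft (History t) (outcomeKernel br)) h)
          ∂historyLaw br π t := by
  have hm := (measurable_history_snoc t).aemeasurable
    (μ := historyLaw br π t ⊗ₘ (π.next t ⊗ₖ Kernel.prodMkLeft (History t) (outcomeKernel br)))
  rw [historyLaw] at hF ⊢
  rw [integral_map hm hF.1]
  have hI := hF.comp_aemeasurable hm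
  exact Measure.integral_compProd hI

/-- If the increments `g` have nonpositive conditional mean given the proposed contract, then so
does their sum along the history. -/
lemma integral_sum_nonpos {g : unitInterval × Fin 2 → ℝ} (hg : Measurable g) {B : ℝ}
    (hB : ∀ x, |g x| ≤ B) (hmean : ∀ α, ∫ o, g (α, o) ∂outcomeKernel br α ≤ 0) (t : ℕ) :
    ∫ h, ∑ i, g (h i) ∂historyLaw br π t ≤ 0 := by
  induction t with
  | zero => simp
  | succ t ih =>
    have hint : ∀ s, Integrable (fun h : History s => ∑ i, g (h i)) (historyLaw br π s) := by
      intro s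
      refine integrable_finsetSum _ fun i _ => ?_
      exact Integrable.of_bound (hg.comp (measurable_pi_apply i)).aestronglyMeasurable B
        (.of_forall fun h => hB _)
    have hgint : ∀ h : History t, Integrable g
        ((π.next t ⊗ₖ Kernel.prodMkLeft (History t) (outcomeKernel br)) h) := fun h =>
      Integrable.of_bound hg.aestronglyMeasurable B (.of_forall hB)
    have hstep : ∀ h : History t,
        ∫ x, ∑ i, g ((Fin.snoc (α := fun _ => unitInterval × Fin 2) h x : History (t + 1)) i)
          ∂((π.next t ⊗ₖ Kernel.prodMkLeft (History t) (outcomeKernel br)) h) =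
        ∑ i, g (h i) +
          ∫ x, g x ∂((π.next t ⊗ₖ Kernel.prodMkLeft (History t) (outcomeKernel br)) h) := by
      intro h
      simp only [Fin.sum_univ_castSucc, Fin.snoc_castSucc, Fin.snoc_last]
      rw [integral_add (integrable_const _) (hgint h)]
      simp
    rw [integral_historyLaw_succ br π t (hint (t + 1))]
    refine le_trans (integral_mono (g := fun h : History t => ∑ i, g (h i)) ?_ (hint t) ?_) ih
    · simp only [hstep]
      refine (hint t).add (Integrable.of_bound (C := B)
        (hg.stronglyMeasurable.integral_kernel).aestronglyMeasurable (.of_forall fun h => ?_))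
      refine (norm_integral_le_of_norm_le_const (.of_forall hB)).trans ?_
      simp
    · intro h
      simp only [hstep]
      rw [add_le_iff_nonpos_right, ProbabilityTheory.integral_compProd (hgint h)]
      exact integral_nonpos hmean

/-- The change of measure between two instances, with the likelihood ratio of the history. -/
lemma lintegral_historyLaw_change {J : SingleTypeInstance 2} (br' : BestResponse J value01)
    {ρ : unitInterval × Fin 2 → ℝ} (hρ : Measurable ρ) (hρ0 : ∀ x, 0 ≤ ρ x)
    (hratio : ∀ α o, outcomeKernel br' α {o} = ENNReal.ofReal (ρ (α, o)) * outcomeKernel br α {o})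
    (t : ℕ) {F : History t → ENNReal} (hF : Measurable F) :
    ∫⁻ h, F h ∂historyLaw br' π t =
      ∫⁻ h, ENNReal.ofReal (∏ i, ρ (h i)) * F h ∂historyLaw br π t := by
  have hprod : ∀ s, Measurable fun h : History s => ENNReal.ofReal (∏ i, ρ (h i)) := fun s =>
    (Finset.measurable_fun_prod _ fun i _ => hρ.comp (measurable_pi_apply i)).ennreal_ofReal
  induction t with
  | zero => simp [historyLaw]
  | succ t ih =>
    have hFs : Measurable fun x : History t × (unitInterval × Fin 2) =>
        F (Fin.snoc (α := fun _ => unitInterval × Fin 2) x.1 x.2) :=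
      hF.comp (measurable_history_snoc t)
    rw [lintegral_historyLaw_succ br' π t hF, ih]
    · refine Eq.trans ?_ (lintegral_historyLaw_succ br π t ((hprod (t + 1)).mul hF)).symm
      refine lintegral_congr fun h => ?_
      have hr : Measurable fun x : unitInterval × Fin 2 => ENNReal.ofReal (ρ x) *
          F (Fin.snoc (α := fun _ => unitInterval × Fin 2) h x) :=
        hρ.ennreal_ofReal.mul (hFs.comp measurable_prodMk_left)
      rw [← lintegral_const_mul' _ _ ENNReal.ofReal_ne_top]
      refine lintegral_congr fun α => ?_
      rw [← lintegral_const_mul' _ _ ENNReal.ofReal_ne_top, lintegral_fintype, lintegral_fintype]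
      refine Finset.sum_congr rfl fun o _ => ?_
      rw [hratio]
      simp only [Pi.mul_apply, Fin.prod_univ_castSucc, Fin.snoc_castSucc, Fin.snoc_last]
      rw [ENNReal.ofReal_mul (Finset.prod_nonneg fun i _ => hρ0 _)]
      ring
    · have h1 : Measurable fun y : (History t × unitInterval) =>
          ∫⁻ o, F (Fin.snoc (α := fun _ => unitInterval × Fin 2) y.1 (y.2, o))
            ∂outcomeKernel br' y.2 := by
        refine Measurable.lintegral_kernel_prod_right'
          (κ := Kernel.prodMkLeft (History t) (outcomeKernel br'))
          (f := fun z : (History t × unitInterval) × Fin 2 =>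
            F (Fin.snoc (α := fun _ => unitInterval × Fin 2) z.1.1 (z.1.2, z.2))) ?_
        have hm : Measurable fun z : (History t × unitInterval) × Fin 2 =>
            (z.1.1, (z.1.2, z.2)) := by fun_prop
        exact hFs.comp hm
      exact h1.lintegral_kernel_prod_right'

lemma historyLaw_eq_withDensity {J : SingleTypeInstance 2} (br' : BestResponse J value01)
    {ρ : unitInterval × Fin 2 → ℝ} (hρ : Measurable ρ) (hρ0 : ∀ x, 0 ≤ ρ x)
    (hratio : ∀ α o, outcomeKernel br' α {o} = ENNReal.ofReal (ρ (α, o)) * outcomeKernel br α {o})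
    (t : ℕ) :
    historyLaw br' π t =
      (historyLaw br π t).withDensity fun h => ENNReal.ofReal (∏ i, ρ (h i)) := by
  ext s hs
  rw [withDensity_apply _ hs, ← lintegral_indicator_one hs,
    lintegral_historyLaw_change br π br' hρ hρ0 hratio t (measurable_one.indicator hs),
    ← lintegral_indicator hs]
  refine lintegral_congr fun h => ?_
  by_cases hh : h ∈ s <;> simp [hh]

end HistoryLaw

/-! ### A cost function with a flat optimum for the principal -/

section Cost

/-- The cost of reaching success probability `q`: it is `q² / 2` up to `1 / 2`, and has derivative
`1 - 1 / (4 q)` afterwards, so that the principal's utility is constant there. -/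
def effortCost (q : ℝ) : ℝ :=
  min q (1 / 2) ^ 2 / 2 + (max q (1 / 2) - 1 / 2 - Real.log (2 * max q (1 / 2)) / 4)

lemma effortCost_of_le {q : ℝ} (h : q ≤ 1 / 2) : effortCost q = q ^ 2 / 2 := by
  rw [effortCost, min_eq_left h, max_eq_right h]
  norm_num

lemma effortCost_of_ge {q : ℝ} (h : 1 / 2 ≤ q) :
    effortCost q = q - 3 / 8 - Real.log (2 * q) / 4 := by
  rw [effortCost, min_eq_right h, max_eq_left h]
  ring

lemma continuous_effortCost : Continuous effortCost := by
  unfold effortCost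
  have h : ∀ q : ℝ, 2 * max q (1 / 2) ≠ 0 := fun q => by
    have := le_max_right q (1 / 2)
    positivity
  have hlog : Continuous fun q : ℝ => Real.log (2 * max q (1 / 2)) :=
    Continuous.log (by fun_prop) h
  fun_prop

lemma effortCost_nonneg (q : ℝ) : 0 ≤ effortCost q := by
  have h := le_max_right q (1 / 2)
  have hl := Real.log_le_sub_one_of_pos (x := 2 * max q (1 / 2)) (by positivity)
  unfold effortCost
  nlinarith [sq_nonneg (min q (1 / 2))]

lemma effortCost_le_one {q : ℝ} (h0 : 0 ≤ q) (h1 : q ≤ 1) : effortCost q ≤ 1 := by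
  rcases le_total q (1 / 2) with h | h
  · rw [effortCost_of_le h]
    nlinarith
  · rw [effortCost_of_ge h]
    linarith [Real.log_nonneg (x := 2 * q) (by linarith)]

/-- On the quadratic branch the deficit is `(q - α)² / 2`. On the logarithmic branch `log x ≤ x - 1`
puts the cost above its tangent line at `1/2`; for `α = 1/2` this inequality must be used in its
strict form. -/
lemma effort_lt_of_le_half {α q : ℝ} (hα : α ≤ 1 / 2) (hq : q ≠ α) :
    α * q - effortCost q < α * α - effortCost α := by
  rw [effortCost_of_le hα]
  rcases le_total q (1 / 2) with h | h
  · rw [effortCost_of_le h]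
    nlinarith [sq_pos_of_ne_zero (sub_ne_zero.2 hq)]
  · rw [effortCost_of_ge h]
    rcases hα.eq_or_lt with rfl | hα'
    · have hl := Real.log_lt_sub_one_of_pos (x := 2 * q) (by linarith)
        (fun e => hq (by linarith))
      linarith
    · have hl := Real.log_le_sub_one_of_pos (x := 2 * q) (by linarith)
      nlinarith [mul_nonneg (sub_nonneg.2 hα) (sub_nonneg.2 h),
        sq_pos_of_pos (sub_pos.2 hα')]

/-- The slope is the marginal cost at `q₀`, so on the logarithmic branch this is strict concavity of
`log`, applied to `q / q₀`. Below `1/2` one compares through `1/2`: it beats `q` at slope `1/2`,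
hence at every larger slope. -/
lemma effort_lt_of_half_le {q₀ q : ℝ} (hq₀ : 1 / 2 ≤ q₀) (hq : q ≠ q₀) :
    (1 - 1 / (4 * q₀)) * q - effortCost q < (1 - 1 / (4 * q₀)) * q₀ - effortCost q₀ := by
  have hpos : 0 < q₀ := by linarith
  have key : ∀ x : ℝ, 1 / 2 ≤ x → x ≠ q₀ →
      (1 - 1 / (4 * q₀)) * x - effortCost x < (1 - 1 / (4 * q₀)) * q₀ - effortCost q₀ := by
    intro x hx hne
    have hx0 : 0 < x := by linarith
    rw [effortCost_of_ge hx, effortCost_of_ge hq₀]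
    have hl := Real.log_lt_sub_one_of_pos (x := x / q₀) (by positivity)
      (by rwa [Ne, div_eq_one_iff_eq hpos.ne'])
    rw [Real.log_div hx0.ne' hpos.ne'] at hl
    rw [Real.log_mul two_ne_zero hx0.ne', Real.log_mul two_ne_zero hpos.ne']
    have e1 : (1 - 1 / (4 * q₀)) * x = x - x / q₀ / 4 := by field_simp
    have e2 : (1 - 1 / (4 * q₀)) * q₀ = q₀ - 1 / 4 := by field_simp
    rw [e1, e2]
    linarith
  rcases le_or_gt (1 / 2) q with h | h
  · exact key q h hq
  · have h1 := effort_lt_of_le_half (le_refl (1 / 2 : ℝ)) h.ne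
    have h2 : (1 - 1 / (4 * q₀)) * (1 / 2) - effortCost (1 / 2) ≤
        (1 - 1 / (4 * q₀)) * q₀ - effortCost q₀ := by
      rcases eq_or_ne (1 / 2) q₀ with e | e
      · rw [← e]
      · exact (key _ le_rfl e).le
    have h3 : 1 / (4 * q₀) ≤ 1 / 2 := by
      rw [div_le_div_iff₀ (by positivity) (by positivity)]
      linarith
    nlinarith

/-- Every contract has a unique optimal success probability in `[0, 3 / 4]`, which leaves the
principal at most `1 / 4`. -/
lemma exists_unique_effort {α : ℝ} (h0 : 0 ≤ α) :
    ∃ q₀ ∈ Set.Icc (0 : ℝ) (3 / 4), (1 - α) * q₀ ≤ 1 / 4 ∧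
      ∀ q ∈ Set.Icc (0 : ℝ) (3 / 4), q ≠ q₀ →
        α * q - effortCost q < α * q₀ - effortCost q₀ := by
  rcases le_total α (1 / 2) with h | h
  · exact ⟨α, ⟨h0, by linarith⟩, by nlinarith [sq_nonneg (α - 1 / 2)],
      fun q _ hq => effort_lt_of_le_half h hq⟩
  rcases le_total α (2 / 3) with h' | h'
  · have hp : 0 < 1 - α := by linarith
    -- The witness inverts the marginal cost `1 - 1 / (4 q) = α`; the principal gets exactly `1/4`.
    refine ⟨1 / (4 * (1 - α)), ⟨by positivity, ?_⟩, by field_simp; rfl, fun q _ hq => ?_⟩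
    · rw [div_le_div_iff₀ (by positivity) (by positivity)]
      linarith
    · have e : 1 - 1 / (4 * (1 / (4 * (1 - α)))) = α := by field_simp; ring
      have := effort_lt_of_half_le (q₀ := 1 / (4 * (1 - α))) (q := q) ?_ hq
      · rwa [e] at this
      · rw [div_le_div_iff₀ (by positivity) (by positivity)]
        linarith
  -- `2/3` is the marginal cost at `3/4`, so from here on the cap binds.
  · refine ⟨3 / 4, ⟨by norm_num, le_rfl⟩, by linarith, fun q hq hne => ?_⟩
    have := effort_lt_of_half_le (q₀ := 3 / 4) (by norm_num) hne
    nlinarith [hq.2]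

/-- The contract at which two success probabilities `a < b` in the flat region give the agent the
same utility lies below `1 - 1 / (4 b)` by an amount linear in `b - a`. -/
lemma effort_lt_of_gap {a b : ℝ} (ha : 1 / 2 ≤ a) (hab : a < b) (hb : b ≤ 3 / 4) :
    (1 - 1 / (4 * b) - (b - a) / 10) * a - effortCost a <
      (1 - 1 / (4 * b) - (b - a) / 10) * b - effortCost b := by
  have ha0 : 0 < a := by linarith
  have hb0 : 0 < b := by linarith
  -- Bounding `log (a / b)` in two steps through the midpoint keeps a term of order `(b - a)²`,
  -- which a single use of `log x ≤ x - 1` loses. As `4 m b ≤ 9/4`, it contributes `(b - a)² / 9`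
  -- after division by `4`, which exceeds the required `(b - a)² / 10`.
  obtain ⟨m, hm⟩ : ∃ m, m = (a + b) / 2 := ⟨_, rfl⟩
  have hm0 : 0 < m := by linarith
  have l1 := Real.log_le_sub_one_of_pos (x := a / m) (by positivity)
  have l2 := Real.log_le_sub_one_of_pos (x := m / b) (by positivity)
  rw [Real.log_div ha0.ne' hm0.ne'] at l1
  rw [Real.log_div hm0.ne' hb0.ne'] at l2
  rw [effortCost_of_ge ha, effortCost_of_ge (ha.trans hab.le),
    Real.log_mul two_ne_zero ha0.ne', Real.log_mul two_ne_zero hb0.ne']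
  have e1 : a / m - 1 + (m / b - 1) = - ((b - a) / b) - (b - a) ^ 2 / (4 * m * b) := by
    subst hm
    field_simp
    ring
  have e2 : (b - a) ^ 2 * (4 / 9) ≤ (b - a) ^ 2 / (4 * m * b) := by
    rw [div_eq_mul_inv]
    refine mul_le_mul_of_nonneg_left ?_ (sq_nonneg _)
    rw [le_inv_comm₀ (by norm_num) (by positivity)]
    nlinarith
  have e3 : 1 / (4 * b) * (b - a) = (b - a) / b / 4 := by field_simp
  nlinarith [sq_pos_of_pos (sub_pos.2 hab)]

end Cost

/-! ### Instances given by a compact set of success probabilities -/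

section Instances

/-- The instance whose actions are the success probabilities in a compact set `S`, at cost
`effortCost`. -/
def effortInstance (S : Set ℝ) (hS : IsCompact S) (hS0 : (0 : ℝ) ∈ S)
    (hS1 : S ⊆ Set.Icc 0 1) : SingleTypeInstance 2 where
  Action := S
  prod q := PMF.ofFintype ![ENNReal.ofReal (1 - q.1), ENNReal.ofReal q.1] (by
    rw [Fin.sum_univ_two]
    simp only [Matrix.cons_val_zero, Matrix.cons_val_one]
    rw [← ENNReal.ofReal_add (by linarith [(hS1 q.2).2]) (hS1 q.2).1]
    simp)
  cost q := effortCost q.1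
  cost_nonneg q := effortCost_nonneg q.1
  cost_le_one q := effortCost_le_one (hS1 q.2).1 (hS1 q.2).2
  null := ⟨0, hS0⟩
  prod_null := by
    ext o
    fin_cases o <;> simp [PMF.ofFintype_apply]
  cost_null := by simp [effortCost_of_le]
  exists_argmax f _ := by
    have hc : Continuous fun q : ℝ => (1 - q) * f 0 + q * f 1 - effortCost q := by
      have := continuous_effortCost
      fun_prop
    obtain ⟨q, hq, hmax⟩ := hS.exists_isMaxOn ⟨0, hS0⟩ hc.continuousOn
    refine ⟨⟨q, hq⟩, fun b => ?_⟩
    have h := hmax b.2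
    simp only [Set.mem_ofPred_eq] at h
    simp only [Fin.sum_univ_two, PMF.ofFintype_apply, Matrix.cons_val_zero, Matrix.cons_val_one]
    rwa [ENNReal.toReal_ofReal (by linarith [(hS1 b.2).2]), ENNReal.toReal_ofReal (hS1 b.2).1,
      ENNReal.toReal_ofReal (by linarith [(hS1 hq).2]), ENNReal.toReal_ofReal (hS1 hq).1]

variable {S : Set ℝ} {hS : IsCompact S} {hS0 : (0 : ℝ) ∈ S} {hS1 : S ⊆ Set.Icc 0 1}

lemma effortInstance_prod_one (q : (effortInstance S hS hS0 hS1).Action) :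
    ((effortInstance S hS hS0 hS1).prod q 1).toReal = q.1 := by
  have : (effortInstance S hS hS0 hS1).prod q 1 = ENNReal.ofReal q.1 := rfl
  rw [this, ENNReal.toReal_ofReal (hS1 q.2).1]

variable (br : BestResponse (effortInstance S hS hS0 hS1) value01)

lemma successProb_mem (α : unitInterval) : successProb br α ∈ S := by
  rw [successProb, effortInstance_prod_one]
  exact (br.act α).2

lemma successProb_isBest (α : unitInterval) {q : ℝ} (hq : q ∈ S) :
    (α : ℝ) * q - effortCost q ≤
      α * successProb br α - effortCost (successProb br α) := by
  obtain ⟨a, rfl⟩ : ∃ a : (effortInstance S hS hS0 hS1).Action, a.1 = q := ⟨⟨q, hq⟩, rfl⟩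
  have h := br.isBest α a
  simp only [SingleTypeInstance.agentUtility, linearContract, value01, Fin.sum_univ_two,
    Matrix.cons_val_zero, Matrix.cons_val_one, mul_zero, zero_add, mul_one,
    effortInstance_prod_one] at h
  rw [successProb, effortInstance_prod_one, mul_comm _ a.1, mul_comm _ (br.act α).1]
  exact h

/-- A strict maximizer leaves no ties to break, so the response is known for every `br`. -/
lemma successProb_eq_of_lt (α : unitInterval) {q₀ : ℝ} (hq₀ : q₀ ∈ S)
    (h : ∀ q ∈ S, q ≠ q₀ → (α : ℝ) * q - effortCost q < α * q₀ - effortCost q₀) :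
    successProb br α = q₀ := by
  by_contra hne
  exact absurd (successProb_isBest br α hq₀) (not_le.2 (h _ (successProb_mem br α) hne))

end Instances

/-- Needed for the reference instance without a gap, where one response map has to be fixed in order
to choose the window. -/
lemma exists_bestResponse {m : ℕ} [NeZero m] (I : SingleTypeInstance m) {v : Fin m → ℝ}
    (hv : ∀ o, v o ∈ Set.Icc (0 : ℝ) 1) : Nonempty (BestResponse I v) := by
  have h : ∀ α : unitInterval, ∃ a, ∀ b, I.agentUtility (linearContract v α) b ≤
      I.agentUtility (linearContract v α) a := fun α =>
    I.exists_argmax (linearContract v α) fun o =>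
      ⟨mul_nonneg α.2.1 (hv o).1, mul_le_one₀ α.2.2 (hv o).1 (hv o).2⟩
  choose a ha using h
  exact ⟨⟨a, ha⟩⟩

/-! ### Comparing visit counts under two instances -/

/-- A pointwise substitute for Pinsker's inequality, in Hellinger style: `(1 - √x)² ≤ x - 1 - log x`
and `1 - x ≤ 2 (1 - √x)`, joined by the arithmetic-geometric mean inequality with weight `δ`. -/
lemma one_sub_le_of_log {x δ : ℝ} (hx : 0 < x) (hδ : 0 < δ) :
    1 - x ≤ δ + (x - 1 - Real.log x) / δ := by
  have hs : 0 < √x := Real.sqrt_pos.2 hx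
  have hsq : √x ^ 2 = x := Real.sq_sqrt hx.le
  have hl := Real.log_le_sub_one_of_pos hs
  rw [Real.log_sqrt hx.le] at hl
  have h1 : (1 - √x) ^ 2 ≤ x - 1 - Real.log x := by nlinarith
  have h2 : 1 - x ≤ 2 * (1 - √x) := by nlinarith [sq_nonneg (1 - √x)]
  have h3 : 2 * (1 - √x) ≤ δ + (1 - √x) ^ 2 / δ := by
    have e : δ + (1 - √x) ^ 2 / δ - 2 * (1 - √x) = (δ - (1 - √x)) ^ 2 / δ := by
      field_simp
      ring
    have : 0 ≤ (δ - (1 - √x)) ^ 2 / δ := by positivity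
    linarith
  have h4 : (1 - √x) ^ 2 / δ ≤ (x - 1 - Real.log x) / δ := by gcongr
  linarith

/-- The relative entropy of two Bernoulli laws is at most their `χ²` divergence. -/
lemma bernoulli_log_ratio_le {p q D : ℝ} (hp : p ∈ Set.Icc (1 / 2 : ℝ) (3 / 4))
    (hq : q ∈ Set.Icc (1 / 2 : ℝ) (3 / 4)) (h : |p - q| ≤ D) :
    (1 - p) * -Real.log ((1 - q) / (1 - p)) + p * -Real.log (q / p) ≤ 6 * D ^ 2 := by
  obtain ⟨hp1, hp2⟩ := hp
  obtain ⟨hq1, hq2⟩ := hq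
  have p0 : 0 < p := by linarith
  have q0 : 0 < q := by linarith
  have p1 : 0 < 1 - p := by linarith
  have q1 : 0 < 1 - q := by linarith
  have l1 := Real.log_le_sub_one_of_pos (x := p / q) (by positivity)
  have l2 := Real.log_le_sub_one_of_pos (x := (1 - p) / (1 - q)) (by positivity)
  rw [← Real.log_inv, ← Real.log_inv, inv_div, inv_div]
  have e : (1 - p) * ((1 - p) / (1 - q) - 1) + p * (p / q - 1) =
      (p - q) ^ 2 / (q * (1 - q)) := by
    field_simp
    ring
  have e2 : (p - q) ^ 2 / (q * (1 - q)) ≤ 6 * (p - q) ^ 2 := by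
    rw [div_le_iff₀ (by positivity)]
    -- On `[1/2, 3/4]` one has `q (1 - q) ≥ 3/16`.
    have : 1 ≤ 6 * (q * (1 - q)) := by nlinarith
    nlinarith [sq_nonneg (p - q)]
  have e3 : (p - q) ^ 2 ≤ D ^ 2 := sq_le_sq' (neg_le_of_abs_le h) (le_of_abs_le h)
  linarith [mul_le_mul_of_nonneg_left l1 p0.le, mul_le_mul_of_nonneg_left l2 p1.le]

/-- The number of rounds in which the proposed contract lies in `W`. -/
def visits (W : Set unitInterval) {t : ℕ} (h : History t) : ℝ :=
  ∑ i, W.indicator (fun _ => (1 : ℝ)) (h i).1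

lemma visits_nonneg (W : Set unitInterval) {t : ℕ} (h : History t) : 0 ≤ visits W h :=
  Finset.sum_nonneg fun _ _ => Set.indicator_nonneg (fun _ _ => zero_le_one) _

lemma visits_le (W : Set unitInterval) {t : ℕ} (h : History t) : visits W h ≤ t := by
  calc visits W h ≤ ∑ _i : Fin t, (1 : ℝ) :=
        Finset.sum_le_sum fun _ _ => Set.indicator_le_self' (fun _ _ => zero_le_one) _
    _ = t := by simp

lemma measurable_visits {W : Set unitInterval} (hW : MeasurableSet W) (t : ℕ) :
    Measurable fun h : History t => visits W h :=
  Finset.measurable_fun_sum _ fun i _ =>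
    (measurable_const.indicator hW).comp (measurable_fst.comp (measurable_pi_apply i))

section Comparison

variable {I J : SingleTypeInstance 2} (br : BestResponse I value01) (br' : BestResponse J value01)
  (π : Policy)

lemma integrable_visits {W : Set unitInterval} (hW : MeasurableSet W) (t : ℕ) :
    Integrable (fun h : History t => visits W h) (historyLaw br π t) :=
  Integrable.of_bound (measurable_visits hW t).aestronglyMeasurable t
    (.of_forall fun h => by
      rw [Real.norm_of_nonneg (visits_nonneg W h)]
      exact visits_le W h)

/-- The likelihood ratio of one round between the two instances, when they differ only on `W`. -/
def likelihoodRatio (W : Set unitInterval) (x : unitInterval × Fin 2) : ℝ :=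
  -- Off `W` the value is `1` by construction, since the quotient would be `0 / 0 = 0` where an
  -- outcome has probability zero.
  {y : unitInterval × Fin 2 | y.1 ∈ W}.indicator (fun y => if y.2 = 1
    then successProb br' y.1 / successProb br y.1 - 1
    else (1 - successProb br' y.1) / (1 - successProb br y.1) - 1) x + 1

lemma measurable_likelihoodRatio {W : Set unitInterval} (hW : MeasurableSet W) :
    Measurable (likelihoodRatio br br' W) := by
  have h := (measurable_successProb br).comp
    (measurable_fst : Measurable (Prod.fst : unitInterval × Fin 2 → _))
  have h' := (measurable_successProb br').comp
    (measurable_fst : Measurable (Prod.fst : unitInterval × Fin 2 → _))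
  refine Measurable.add_const (Measurable.indicator ?_ (measurable_fst hW)) 1
  refine Measurable.ite (measurable_snd (MeasurableSet.singleton 1))
    ((h'.div h).sub_const 1) (((h'.const_sub 1).div (h.const_sub 1)).sub_const 1)

lemma likelihoodRatio_of_notMem {W : Set unitInterval} {α : unitInterval} (hα : α ∉ W)
    (o : Fin 2) : likelihoodRatio br br' W (α, o) = 1 := by
  simp [likelihoodRatio, hα]

lemma likelihoodRatio_one {W : Set unitInterval} {α : unitInterval} (hα : α ∈ W) :
    likelihoodRatio br br' W (α, 1) = successProb br' α / successProb br α := by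
  simp [likelihoodRatio, hα]

lemma likelihoodRatio_zero {W : Set unitInterval} {α : unitInterval} (hα : α ∈ W) :
    likelihoodRatio br br' W (α, 0) = (1 - successProb br' α) / (1 - successProb br α) := by
  simp [likelihoodRatio, hα]

variable {br br'} {W : Set unitInterval}
  (hout : ∀ α ∉ W, successProb br' α = successProb br α)
  (hin : ∀ α ∈ W, successProb br α ∈ Set.Icc (1 / 2 : ℝ) (3 / 4))
  (hin' : ∀ α ∈ W, successProb br' α ∈ Set.Icc (1 / 2 : ℝ) (3 / 4))

include hin hin' in
-- Both outcomes have probability at least `1/4` on `W`, and the complements lie in `[1/4, 1/2]`.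
-- The two-sided bound makes products of ratios and their logarithms bounded, hence integrable.
lemma likelihoodRatio_mem (x : unitInterval × Fin 2) :
    likelihoodRatio br br' W x ∈ Set.Icc (1 / 2 : ℝ) 2 := by
  obtain ⟨α, o⟩ := x
  by_cases hα : α ∈ W
  · obtain ⟨h1, h2⟩ := hin α hα
    obtain ⟨h1', h2'⟩ := hin' α hα
    fin_cases o
    · have e := likelihoodRatio_zero br br' hα
      simp only [Fin.zero_eta, e, Set.mem_Icc]
      constructor
      · rw [le_div_iff₀ (by linarith)]; linarith
      · rw [div_le_iff₀ (by linarith)]; linarith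
    · have e := likelihoodRatio_one br br' hα
      simp only [Fin.mk_one, e, Set.mem_Icc]
      constructor
      · rw [le_div_iff₀ (by linarith)]; linarith
      · rw [div_le_iff₀ (by linarith)]; linarith
  · rw [likelihoodRatio_of_notMem _ _ hα]
    norm_num

include hout hin in
lemma outcomeKernel_eq_likelihoodRatio_mul (α : unitInterval) (o : Fin 2) :
    outcomeKernel br' α {o} =
      ENNReal.ofReal (likelihoodRatio br br' W (α, o)) * outcomeKernel br α {o} := by
  by_cases hα : α ∈ W
  · obtain ⟨h1, h2⟩ := hin α hα
    have hp' := successProb_nonneg br' α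
    have hp1' := successProb_le_one br' α
    have n0 : successProb br α ≠ 0 := by linarith
    have n1 : 1 - successProb br α ≠ 0 := by linarith
    fin_cases o
    · have e := likelihoodRatio_zero br br' hα
      simp only [Fin.zero_eta, e, outcomeKernel_zero]
      rw [← ENNReal.ofReal_mul (div_nonneg (by linarith) (by linarith)), div_mul_cancel₀ _ n1]
    · have e := likelihoodRatio_one br br' hα
      simp only [Fin.mk_one, e, outcomeKernel_one]
      rw [← ENNReal.ofReal_mul (div_nonneg (by linarith) (by linarith)), div_mul_cancel₀ _ n0]
  · rw [likelihoodRatio_of_notMem _ _ hα, ENNReal.ofReal_one, one_mul]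
    fin_cases o
    · simp [outcomeKernel_zero, hout α hα]
    · simp [outcomeKernel_one, hout α hα]

include hin hin' in
/-- The relative entropy of the histories is controlled by the expected number of visits to the
set where the two instances differ. -/
lemma integral_neg_log_likelihoodRatio_le (hW : MeasurableSet W) {D : ℝ}
    (hD : ∀ α ∈ W, |successProb br α - successProb br' α| ≤ D) (t : ℕ) :
    ∫ h, -Real.log (∏ i, likelihoodRatio br br' W (h i)) ∂historyLaw br π t ≤
      6 * D ^ 2 * ∫ h, visits W h ∂historyLaw br π t := by
  have hpos : ∀ x, 0 < likelihoodRatio br br' W x := fun x => by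
    linarith [(likelihoodRatio_mem hin hin' x).1]
  have hlog : ∀ x, |Real.log (likelihoodRatio br br' W x)| ≤ 1 := by
    intro x
    obtain ⟨h1, h2⟩ := likelihoodRatio_mem hin hin' x
    have a1 := Real.log_le_sub_one_of_pos (hpos x)
    have a2 := Real.log_le_sub_one_of_pos (inv_pos.2 (hpos x))
    rw [Real.log_inv] at a2
    have a3 : (likelihoodRatio br br' W x)⁻¹ ≤ 2 := by
      rw [inv_le_comm₀ (hpos x) two_pos]; linarith
    rw [abs_le]
    constructor <;> linarith
  have hlm := (measurable_likelihoodRatio br br' hW).log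
  have hind : ∀ α, W.indicator (fun _ => (1 : ℝ)) α ∈ Set.Icc (0 : ℝ) 1 := fun α =>
    ⟨Set.indicator_nonneg (fun _ _ => zero_le_one) _,
      Set.indicator_le_self' (fun _ _ => zero_le_one) _⟩
  -- Compensating each log-ratio by `6 D²` per visit leaves increments of nonpositive conditional
  -- mean.
  have key := integral_sum_nonpos br π
    (g := fun x => -Real.log (likelihoodRatio br br' W x) -
      6 * D ^ 2 * W.indicator (fun _ => (1 : ℝ)) x.1)
    (hlm.neg.sub (((measurable_const.indicator hW).comp measurable_fst).const_mul _))
    (B := 1 + 6 * D ^ 2) ?_ ?_ t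
  · have hi : Integrable (fun h : History t => ∑ i, -Real.log (likelihoodRatio br br' W (h i)))
        (historyLaw br π t) := by
      refine integrable_finsetSum _ fun i _ => ?_
      refine Integrable.of_bound (hlm.neg.comp (measurable_pi_apply i)).aestronglyMeasurable 1
        (.of_forall fun h => ?_)
      rw [Real.norm_eq_abs, abs_neg]
      exact hlog _
    have e : ∀ h : History t, -Real.log (∏ i, likelihoodRatio br br' W (h i)) =
        ∑ i, -Real.log (likelihoodRatio br br' W (h i)) := fun h => by
      rw [Real.log_prod fun i _ => (hpos _).ne', Finset.sum_neg_distrib]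
    simp only [e]
    simp only [Finset.sum_sub_distrib, ← Finset.mul_sum] at key
    change ∫ h : History t, (∑ i, -Real.log (likelihoodRatio br br' W (h i)) -
      6 * D ^ 2 * visits W h) ∂historyLaw br π t ≤ 0 at key
    have hV : Integrable (fun h : History t => 6 * D ^ 2 * visits W h) (historyLaw br π t) :=
      (integrable_visits br π hW t).const_mul _
    rw [integral_sub hi hV, integral_const_mul] at key
    exact sub_nonpos.1 key
  · intro x
    have h1 := abs_le.1 (hlog x)
    have h2 := hind x.1
    have h3 : 0 ≤ D ^ 2 := sq_nonneg D
    rw [abs_le]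
    constructor <;> nlinarith [h2.1, h2.2]
  · intro α
    rw [integral_fintype (Integrable.of_finite), Fin.sum_univ_two]
    simp only [Measure.real, outcomeKernel_zero, outcomeKernel_one, smul_eq_mul]
    rw [ENNReal.toReal_ofReal (by linarith [successProb_le_one br α]),
      ENNReal.toReal_ofReal (successProb_nonneg br α)]
    by_cases hα : α ∈ W
    · rw [likelihoodRatio_zero _ _ hα, likelihoodRatio_one _ _ hα, Set.indicator_of_mem hα]
      linarith [bernoulli_log_ratio_le (hin α hα) (hin' α hα) (hD α hα)]
    · rw [likelihoodRatio_of_notMem _ _ hα, likelihoodRatio_of_notMem _ _ hα,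
        Set.indicator_of_notMem hα]
      simp

include hout hin hin' in
/-- The expected number of visits to the set `W` where two instances differ can only be much larger
under the second instance if it is already substantial under the first one. -/
lemma integral_visits_le (hW : MeasurableSet W) {D δ : ℝ} (hδ : 0 < δ)
    (hD : ∀ α ∈ W, |successProb br α - successProb br' α| ≤ D) (t : ℕ) :
    ∫ h, visits W h ∂historyLaw br' π t ≤ ∫ h, visits W h ∂historyLaw br π t +
      t * (δ + 6 * D ^ 2 * (∫ h, visits W h ∂historyLaw br π t) / δ) := by
  have hmem := likelihoodRatio_mem hin hin'
  have hpos : ∀ x, 0 < likelihoodRatio br br' W x := fun x => by linarith [(hmem x).1]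
  set L : History t → ℝ := fun h => ∏ i, likelihoodRatio br br' W (h i) with hL
  have hLpos : ∀ h, 0 < L h := fun h => Finset.prod_pos fun i _ => hpos _
  have hLm : Measurable L := Finset.measurable_fun_prod _ fun i _ =>
    (measurable_likelihoodRatio br br' hW).comp (measurable_pi_apply i)
  have hLle : ∀ h, L h ≤ 2 ^ t := fun h => by
    calc L h ≤ ∏ _i : Fin t, (2 : ℝ) :=
          Finset.prod_le_prod (fun i _ => (hpos _).le) fun i _ => (hmem _).2
      _ = 2 ^ t := by simp
  have hLge : ∀ h, (1 / 2) ^ t ≤ L h := fun h => by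
    calc (1 / 2 : ℝ) ^ t = ∏ _i : Fin t, (1 / 2 : ℝ) := by simp
      _ ≤ L h := Finset.prod_le_prod (fun i _ => by norm_num) fun i _ => (hmem _).1
  have hLi : Integrable L (historyLaw br π t) :=
    Integrable.of_bound hLm.aestronglyMeasurable (2 ^ t) (.of_forall fun h => by
      rw [Real.norm_of_nonneg (hLpos h).le]; exact hLle h)
  have hlogi : Integrable (fun h => -Real.log (L h)) (historyLaw br π t) := by
    refine Integrable.of_bound hLm.log.neg.aestronglyMeasurable (2 ^ t) (.of_forall fun h => ?_)
    rw [Real.norm_eq_abs, abs_neg, abs_le]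
    have a1 := Real.log_le_sub_one_of_pos (hLpos h)
    have a2 := Real.log_le_sub_one_of_pos (inv_pos.2 (hLpos h))
    rw [Real.log_inv] at a2
    have a3 : (L h)⁻¹ ≤ 2 ^ t := by
      rw [inv_le_comm₀ (hLpos h) (by positivity), ← inv_pow, inv_eq_one_div]
      exact hLge h
    constructor <;> linarith [hLle h]
  have hV := integrable_visits br π hW t
  have change : ∀ f : History t → ℝ,
      ∫ h, f h ∂historyLaw br' π t = ∫ h, L h * f h ∂historyLaw br π t := by
    intro f
    rw [historyLaw_eq_withDensity br π br' (measurable_likelihoodRatio br br' hW)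
      (fun x => (hpos x).le) (outcomeKernel_eq_likelihoodRatio_mul hout hin) t,
      integral_withDensity_eq_integral_toReal_smul hLm.ennreal_ofReal
        (.of_forall fun h => ENNReal.ofReal_lt_top)]
    refine integral_congr_ae (.of_forall fun h => ?_)
    simp only [smul_eq_mul]
    rw [ENNReal.toReal_ofReal (hLpos h).le]
  have hone : ∫ h, L h ∂historyLaw br π t = 1 := by
    have := change fun _ => 1
    simpa using this.symm
  -- The excess is at most `t` times the positive part of `L - 1`, which is `L - 1` plus the
  -- positive part of `1 - L`. The first has mean zero and the second is bounded by
  -- `one_sub_le_of_log`.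
  have hpt : ∀ h, L h * visits W h ≤
      visits W h + t * (L h - 1 + δ + (L h - 1 + -Real.log (L h)) / δ) := by
    intro h
    have b1 := one_sub_le_of_log (hLpos h) hδ
    have b2 := Real.log_le_sub_one_of_pos (hLpos h)
    have b3 : 0 ≤ (L h - 1 - Real.log (L h)) / δ := div_nonneg (by linarith) hδ.le
    rw [← sub_eq_add_neg]
    have v0 := visits_nonneg W h
    have v1 := visits_le W h
    have ht : (0 : ℝ) ≤ t := Nat.cast_nonneg t
    rcases le_total (L h) 1 with hle | hle
    · nlinarith
    · nlinarith
  have hE := integral_neg_log_likelihoodRatio_le π hin hin' hW hD t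
  have hL1 : Integrable (fun h => L h - 1) (historyLaw br π t) := hLi.sub (integrable_const 1)
  have hA : Integrable (fun h => L h - 1 + δ) (historyLaw br π t) :=
    hL1.add (integrable_const δ)
  have hB : Integrable (fun h => (L h - 1 + -Real.log (L h)) / δ) (historyLaw br π t) :=
    (hL1.add hlogi).div_const δ
  have hAB : Integrable (fun h => t * (L h - 1 + δ + (L h - 1 + -Real.log (L h)) / δ))
      (historyLaw br π t) := (hA.add hB).const_mul _
  have hLV : Integrable (fun h => L h * visits W h) (historyLaw br π t) :=
    hV.bdd_mul hLm.aestronglyMeasurable (c := 2 ^ t) (.of_forall fun h => by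
      rw [Real.norm_of_nonneg (hLpos h).le]; exact hLle h)
  have hL0 : ∫ h, (L h - 1) ∂historyLaw br π t = 0 := by
    rw [integral_sub hLi (integrable_const 1), hone]
    simp
  calc ∫ h, visits W h ∂historyLaw br' π t
      = ∫ h, L h * visits W h ∂historyLaw br π t := change _
    _ ≤ ∫ h, (visits W h + t * (L h - 1 + δ + (L h - 1 + -Real.log (L h)) / δ))
          ∂historyLaw br π t :=
        integral_mono hLV (hV.add hAB) hpt
    _ = ∫ h, visits W h ∂historyLaw br π t +
          t * (δ + (∫ h, -Real.log (L h) ∂historyLaw br π t) / δ) := by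
        rw [integral_add hV hAB, integral_const_mul, integral_add hA hB,
          integral_add hL1 (integrable_const δ), integral_div, integral_add hL1 hlogi, hL0]
        simp
    _ ≤ _ := by gcongr

end Comparison

/-! ### Deleting an interval of success probabilities -/

section GapInstance

/-- The success probabilities in `[0, 3 / 4]` outside the open gap `(a, b)`. -/
def gapSet (a b : ℝ) : Set ℝ := Set.Icc 0 (3 / 4) \ Set.Ioo a b

lemma gapSet_subset (a b : ℝ) : gapSet a b ⊆ Set.Icc 0 (3 / 4) := Set.sdiff_subset

/-- The instance in which the success probabilities in `(a, b)` are not available. -/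
def gapInstance (a b : ℝ) (ha : 0 ≤ a) : SingleTypeInstance 2 :=
  effortInstance (gapSet a b) (isCompact_Icc.diff isOpen_Ioo)
    ⟨by norm_num, fun h => not_lt.2 ha h.1⟩
    ((gapSet_subset a b).trans (Set.Icc_subset_Icc_right (by norm_num)))

/-- `Ioo 0 0` is empty, so the reference instance is a degenerate gap instance and shares its
lemmas. -/
lemma mem_gapSet_self (q : ℝ) : q ∈ gapSet 0 0 ↔ q ∈ Set.Icc (0 : ℝ) (3 / 4) := by
  simp [gapSet]

variable {a b : ℝ} {ha₀ : 0 ≤ a}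

lemma gap_successProb_mem (br : BestResponse (gapInstance a b ha₀) value01) (α : unitInterval) :
    successProb br α ∈ gapSet a b :=
  successProb_mem (S := gapSet a b) br α

lemma gap_successProb_isBest (br : BestResponse (gapInstance a b ha₀) value01) (α : unitInterval)
    {q : ℝ} (hq : q ∈ gapSet a b) :
    (α : ℝ) * q - effortCost q ≤ α * successProb br α - effortCost (successProb br α) :=
  successProb_isBest (S := gapSet a b) br α hq

lemma gap_successProb_eq_of_half_le (br : BestResponse (gapInstance a b ha₀) value01)
    {q : ℝ} (hq : 1 / 2 ≤ q) (hmem : q ∈ gapSet a b) {α : unitInterval}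
    (hα : (α : ℝ) = 1 - 1 / (4 * q)) : successProb br α = q := by
  refine successProb_eq_of_lt (S := gapSet a b) br α hmem fun x _ hx => ?_
  rw [hα]
  exact effort_lt_of_half_le hq hx

variable (br₀ : BestResponse (gapInstance 0 0 le_rfl) value01)

lemma base_successProb_unique (α : unitInterval) :
    (1 - (α : ℝ)) * successProb br₀ α ≤ 1 / 4 ∧
      ∀ q ∈ Set.Icc (0 : ℝ) (3 / 4), q ≠ successProb br₀ α →
        (α : ℝ) * q - effortCost q <
          α * successProb br₀ α - effortCost (successProb br₀ α) := by
  obtain ⟨q₀, hq₀, hu, hlt⟩ := exists_unique_effort α.2.1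
  have : successProb br₀ α = q₀ :=
    successProb_eq_of_lt (S := gapSet 0 0) br₀ α ((mem_gapSet_self q₀).2 hq₀)
      fun q hq => hlt q (gapSet_subset _ _ hq)
  rw [this]
  exact ⟨hu, hlt⟩

/-- Outside the contracts to which the agent would respond within the gap, the gap is irrelevant. -/
lemma gap_successProb_eq_base (br : BestResponse (gapInstance a b ha₀) value01)
    {α : unitInterval} (hα : successProb br₀ α ∉ Set.Ioo a b) :
    successProb br α = successProb br₀ α :=
  successProb_eq_of_lt (S := gapSet a b) br α
    ⟨(mem_gapSet_self _).1 (gap_successProb_mem br₀ α), hα⟩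
    fun q hq => (base_successProb_unique br₀ α).2 q (gapSet_subset _ _ hq)

lemma one_sub_inv_mem_unitInterval {q : ℝ} (hq : 1 / 2 ≤ q) :
    1 - 1 / (4 * q) ∈ Set.Icc (0 : ℝ) 1 := by
  have h : 1 / (4 * q) ≤ 1 / 2 := by
    rw [div_le_div_iff₀ (by linarith) (by norm_num)]
    linarith
  have h' : 0 ≤ 1 / (4 * q) := by positivity
  constructor <;> linarith

variable (br : BestResponse (gapInstance a b ha₀) value01)

section

variable (ha : 1 / 2 ≤ a) (hab : a < b) (hb : b ≤ 3 / 4)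

include ha hab hb

/-- Both instances respond to the contracts `1 - 1/(4a)` and `1 - 1/(4b)` with `a` and `b`;
monotonicity of the responses does the rest. -/
lemma gap_bounds_of_mem {α : unitInterval} (hα : successProb br₀ α ∈ Set.Ioo a b) :
    successProb br α ∈ Set.Icc a b ∧ 1 - 1 / (4 * a) ≤ (α : ℝ) := by
  have hamem : a ∈ gapSet a b := ⟨⟨by linarith, by linarith⟩, fun h => lt_irrefl _ h.1⟩
  have hbmem : b ∈ gapSet a b := ⟨⟨by linarith, hb⟩, fun h => lt_irrefl _ h.2⟩
  let αa : unitInterval := ⟨_, one_sub_inv_mem_unitInterval ha⟩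
  let αb : unitInterval := ⟨_, one_sub_inv_mem_unitInterval (ha.trans hab.le)⟩
  have h1 : successProb br αa = a := gap_successProb_eq_of_half_le br ha hamem rfl
  have h2 : successProb br αb = b :=
    gap_successProb_eq_of_half_le br (ha.trans hab.le) hbmem rfl
  have h3 : successProb br₀ αa = a :=
    gap_successProb_eq_of_half_le br₀ ha ((mem_gapSet_self _).2 hamem.1) rfl
  have h4 : successProb br₀ αb = b :=
    gap_successProb_eq_of_half_le br₀ (ha.trans hab.le) ((mem_gapSet_self _).2 hbmem.1) rfl
  have h5 : αa ≤ α := by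
    by_contra hcon
    linarith [successProb_monotone br₀ (not_le.1 hcon).le, hα.1]
  have h6 : α ≤ αb := by
    by_contra hcon
    linarith [successProb_monotone br₀ (not_le.1 hcon).le, hα.2]
  refine ⟨⟨?_, ?_⟩, h5⟩
  · exact h1.symm.le.trans (successProb_monotone br h5)
  · calc successProb br α ≤ successProb br αb := successProb_monotone br h6
      _ = b := h2

/-- In the window the principal keeps a share of at most `1/(4a)` and success has probability at
most `b`, so the payoff is at most `b/(4a)`. Elsewhere the response is that of the reference
instance. -/
lemma gap_utility_le (α : unitInterval) :
    utility br α ≤ 1 / 4 + (b - a) / 2 *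
      (successProb br₀ ⁻¹' Set.Ioo a b).indicator (fun _ => (1 : ℝ)) α := by
  rw [utility_eq]
  by_cases hα : successProb br₀ α ∈ Set.Ioo a b
  · rw [Set.indicator_of_mem (by exact hα)]
    obtain ⟨⟨h1, h2⟩, h3⟩ := gap_bounds_of_mem br₀ br ha hab hb hα
    have ha0 : 0 < a := by linarith
    have h4 : (1 - (α : ℝ)) * successProb br α ≤ 1 / (4 * a) * b :=
      mul_le_mul (by linarith) h2 (by linarith) (by positivity)
    have h5 : 1 / (4 * a) * b = 1 / 4 + (b - a) * (1 / (4 * a)) := by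
      field_simp
      ring
    have h6 : 1 / (4 * a) ≤ 1 / 2 := by
      rw [div_le_div_iff₀ (by linarith) (by norm_num)]
      linarith
    nlinarith
  · rw [Set.indicator_of_notMem (by exact hα), gap_successProb_eq_base br₀ br hα]
    linarith [(base_successProb_unique br₀ α).1]

/-- At the contract of `effort_lt_of_gap` the agent prefers `b` to `a`. Its response is at least `a`
by monotonicity, and the gap then forces it up to at least `b`. -/
lemma exists_gap_utility_ge :
    ∃ α : unitInterval, 1 / 4 + (b - a) / 20 ≤ utility br α := by
  have ha0 : 0 < a := by linarith
  have hb0 : 0 < b := by linarith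
  have hamem : a ∈ gapSet a b := ⟨⟨by linarith, by linarith⟩, fun h => lt_irrefl _ h.1⟩
  have hbmem : b ∈ gapSet a b := ⟨⟨by linarith, hb⟩, fun h => lt_irrefl _ h.2⟩
  have hA := one_sub_inv_mem_unitInterval ha
  have hB := one_sub_inv_mem_unitInterval (ha.trans hab.le)
  have hle : 1 - 1 / (4 * a) ≤ 1 - 1 / (4 * b) - (b - a) / 10 := by
    have e : 1 / (4 * a) - 1 / (4 * b) = (b - a) / (4 * a * b) := by
      field_simp
    have e2 : (b - a) / 10 ≤ (b - a) / (4 * a * b) := by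
      have : 4 * a * b ≤ 10 := by nlinarith
      gcongr
    linarith
  let α : unitInterval := ⟨1 - 1 / (4 * b) - (b - a) / 10, by linarith [hA.1], by linarith [hB.2]⟩
  have hαval : (α : ℝ) = 1 - 1 / (4 * b) - (b - a) / 10 := rfl
  let αa : unitInterval := ⟨_, hA⟩
  have h1 : successProb br αa = a := gap_successProb_eq_of_half_le br ha hamem rfl
  have h2 : a ≤ successProb br α := h1.symm.le.trans (successProb_monotone br hle)
  have h3 : successProb br α ≠ a := by
    intro h
    have := gap_successProb_isBest br α hbmem
    rw [h, hαval] at this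
    exact absurd this (not_le.2 (effort_lt_of_gap ha hab hb))
  have h4 : b ≤ successProb br α := by
    by_contra hcon
    exact (gap_successProb_mem br α).2 ⟨lt_of_le_of_ne h2 h3.symm, not_le.1 hcon⟩
  refine ⟨α, ?_⟩
  rw [utility_eq, hαval]
  have h5 : (1 / (4 * b) + (b - a) / 10) * b ≤
      (1 - (1 - 1 / (4 * b) - (b - a) / 10)) * successProb br α := by
    rw [show 1 - (1 - 1 / (4 * b) - (b - a) / 10) = 1 / (4 * b) + (b - a) / 10 by ring]
    refine mul_le_mul_of_nonneg_left h4 (add_nonneg (by positivity) (by linarith))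
  have h6 : (1 / (4 * b) + (b - a) / 10) * b = 1 / 4 + (b - a) / 10 * b := by
    field_simp
  nlinarith

end

end GapInstance

/-! ### Lower bounds for the regret -/

section Regret

variable {I : SingleTypeInstance 2} (br : BestResponse I value01) (π : Policy) (T : ℕ)

lemma abs_utility_sub_le_one (α β : unitInterval) : |utility br α - utility br β| ≤ 1 := by
  rw [abs_le]
  constructor <;> linarith [utility_nonneg br α, utility_le_one br α, utility_nonneg br β,
    utility_le_one br β]

/-- The bound by `T` matters: a real supremum over an unbounded family would default to `0`. -/
lemma le_regret (α : unitInterval) :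
    ∑ t : Fin T, ∫ h : History T, (utility br α - utility br (h t).1) ∂historyLaw br π T ≤
      regret br π T := by
  refine le_ciSup (f := fun α : unitInterval => ∑ t : Fin T,
    ∫ h : History T, (utility br α - utility br (h t).1) ∂historyLaw br π T) ⟨T, ?_⟩ α
  rintro _ ⟨β, rfl⟩
  calc ∑ t : Fin T, ∫ h : History T, (utility br β - utility br (h t).1) ∂historyLaw br π T
      ≤ ∑ _t : Fin T, (1 : ℝ) := Finset.sum_le_sum fun t _ => by
        refine (le_abs_self _).trans ?_
        have := norm_integral_le_of_norm_le_const (μ := historyLaw br π T) (C := 1)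
          (f := fun h : History T => utility br β - utility br (h t).1)
          (.of_forall fun h => abs_utility_sub_le_one br _ _)
        simpa using this
    _ = T := by simp

/-- If the contracts outside `W` are worse than `α` by `g`, and those in `W` better by at most
`c - g`, then the regret is large unless `W` is visited often. -/
lemma le_regret_of_utility_gap {W : Set unitInterval} (hW : MeasurableSet W) {α : unitInterval}
    {g c : ℝ} (h : ∀ β, utility br β ≤
      utility br α - g + c * W.indicator (fun _ => (1 : ℝ)) β) :
    T * g - c * ∫ h, visits W h ∂historyLaw br π T ≤ regret br π T := by
  refine le_trans ?_ (le_regret br π T α)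
  have hi : ∀ t : Fin T, Integrable
      (fun h : History T => utility br α - utility br (h t).1) (historyLaw br π T) := fun t =>
    Integrable.of_bound (((measurable_utility br).comp
      (measurable_fst.comp (measurable_pi_apply t))).const_sub _).aestronglyMeasurable 1
      (.of_forall fun h => abs_utility_sub_le_one br _ _)
  have hV : Integrable (fun h : History T => c * visits W h) (historyLaw br π T) :=
    (integrable_visits br π hW T).const_mul c
  rw [← integral_finsetSum _ fun t _ => hi t]
  calc T * g - c * ∫ h, visits W h ∂historyLaw br π T
      = ∫ h, (T * g - c * visits W h) ∂historyLaw br π T := by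
        rw [integral_sub (integrable_const _) hV, integral_const, integral_const_mul]
        simp
    _ ≤ _ := by
        refine integral_mono ((integrable_const _).sub hV)
          (integrable_finsetSum _ fun t _ => hi t) fun x => ?_
        have e : T * g - c * visits W x =
            ∑ t : Fin T, (g - c * W.indicator (fun _ => (1 : ℝ)) (x t).1) := by
          rw [Finset.sum_sub_distrib, visits, Finset.mul_sum]
          simp
        simp only [e]
        exact Finset.sum_le_sum fun t _ => by linarith [h (x t).1]

/-- Each round visits at most one of the disjoint sets. -/
lemma sum_integral_visits_le {ι : Type*} (s : Finset ι) {W : ι → Set unitInterval}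
    (hW : ∀ i, MeasurableSet (W i)) (hdisj : Pairwise fun i j => Disjoint (W i) (W j)) :
    ∑ i ∈ s, ∫ h, visits (W i) h ∂historyLaw br π T ≤ T := by
  rw [← integral_finsetSum _ fun i _ => integrable_visits br π (hW i) T]
  have hle : ∀ h : History T, ∑ i ∈ s, visits (W i) h ≤ T := by
    intro h
    have e : ∑ i ∈ s, visits (W i) h = visits (⋃ i ∈ s, W i) h := by
      simp only [visits]
      rw [Finset.sum_comm]
      refine Finset.sum_congr rfl fun t _ => ?_
      rw [Finset.indicator_biUnion s W fun i _ j _ hij => hdisj hij]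
    rw [e]
    exact visits_le _ h
  calc ∫ h, ∑ i ∈ s, visits (W i) h ∂historyLaw br π T
      ≤ ∫ _h, (T : ℝ) ∂historyLaw br π T :=
        integral_mono (integrable_finsetSum _ fun i _ => integrable_visits br π (hW i) T)
          (integrable_const _) hle
    _ = T := by simp

end Regret

/-! ### Choice of the gap and of the constants -/

/-- If the gap instance's window is rarely visited under the base instance, then the policy has
large regret in the gap instance. -/
lemma gap_regret_ge (br₀ : BestResponse (gapInstance 0 0 le_rfl) value01) (π : Policy) (T : ℕ)
    {a b : ℝ} {ha₀ : 0 ≤ a} (ha : 1 / 2 ≤ a) (hab : a < b) (hb : b ≤ 3 / 4)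
    (br : BestResponse (gapInstance a b ha₀) value01) {ε : ℝ} (hε : ε ≤ 1 / 40)
    (hvisits : ∫ h, visits (successProb br₀ ⁻¹' Set.Ioo a b) h ∂historyLaw br₀ π T ≤ T * ε)
    (hinfo : 480 * (b - a) ^ 2 * (T * ε) ≤ 1 / 100) :
    T * (b - a) / 40 ≤ regret br π T := by
  set W := successProb br₀ ⁻¹' Set.Ioo a b with hWdef
  have hW : MeasurableSet W := measurable_successProb br₀ measurableSet_Ioo
  obtain ⟨α, hα⟩ := exists_gap_utility_ge br ha hab hb
  have hreg := le_regret_of_utility_gap br π T hW (α := α) (g := (b - a) / 20) (c := (b - a) / 2)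
    fun β => (gap_utility_le br₀ br ha hab hb β).trans (by linarith)
  have hbounds : ∀ β ∈ W, successProb br β ∈ Set.Icc a b := fun β hβ =>
    (gap_bounds_of_mem br₀ br ha hab hb hβ).1
  have hsub : Set.Icc a b ⊆ Set.Icc (1 / 2) (3 / 4) := Set.Icc_subset_Icc ha hb
  -- With `δ = 1/80` the visited fraction is at most `1/40 + 1/80 + 1/100 ≤ 1/20`. At gain `(b - a)
  -- / 2` per visit this offsets at most half of `T (b - a) / 20`.
  have hcmp := integral_visits_le (br := br₀) (br' := br) π (W := W)
    (fun β hβ => gap_successProb_eq_base br₀ br hβ)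
    (fun β hβ => hsub ⟨hβ.1.le, hβ.2.le⟩)
    (fun β hβ => hsub (hbounds β hβ)) hW (D := b - a) (δ := 1 / 80) (by norm_num)
    (fun β hβ => by
      have h1 := hbounds β hβ
      rw [abs_le]
      constructor <;> linarith [h1.1, h1.2, hβ.1, hβ.2]) T
  set V := ∫ h, visits W h ∂historyLaw br₀ π T
  have hT : (0 : ℝ) ≤ T := Nat.cast_nonneg T
  have h1 : 6 * (b - a) ^ 2 * V / (1 / 80) ≤ 1 / 100 := by
    calc 6 * (b - a) ^ 2 * V / (1 / 80) = 480 * (b - a) ^ 2 * V := by ring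
      _ ≤ 480 * (b - a) ^ 2 * (T * ε) := by gcongr
      _ ≤ 1 / 100 := hinfo
  have h2 : V ≤ T * (1 / 40) := hvisits.trans (by gcongr)
  have h3 : ∫ h, visits W h ∂historyLaw br π T ≤ T * (1 / 20) := by
    have : T * (1 / 80 + 6 * (b - a) ^ 2 * V / (1 / 80)) ≤ T * (1 / 80 + 1 / 100 : ℝ) := by
      gcongr
    linarith
  have h4 : (b - a) / 2 * ∫ h, visits W h ∂historyLaw br π T ≤ (b - a) / 2 * (T * (1 / 20)) :=
    mul_le_mul_of_nonneg_left h3 (by linarith)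
  linarith

end OnlineContract

end

open OnlineContract in
-- The interval `[1/2, 3/4]` is cut into `40 n` pieces of width `D = 1/(160 n)`, and `T D / 40` is
-- the regret bound.
lemma exists_gapInstance_regret_ge (T : ℕ) (hT : 0 < T) (π : Policy) (n : ℕ) (hn : T ≤ n ^ 3) :
    ∃ I : SingleTypeInstance 2, ∀ br : BestResponse I value01,
      (T : ℝ) / (6400 * n) ≤ regret br π T := by
  have hv : ∀ o, value01 o ∈ Set.Icc (0 : ℝ) 1 := by
    intro o
    fin_cases o <;> simp [value01]
  obtain ⟨br₀⟩ := exists_bestResponse (gapInstance 0 0 le_rfl) hv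
  have hn0 : 0 < n := Nat.pos_of_ne_zero fun h => by simp [h] at hn; omega
  have hnR : (1 : ℝ) ≤ n := by exact_mod_cast hn0
  have hTn : (T : ℝ) ≤ n ^ 3 := by exact_mod_cast hn
  set D : ℝ := 1 / (160 * n) with hD
  have hDpos : 0 < D := by positivity
  let q : ℕ → ℝ := fun k => 1 / 2 + k * D
  have hq : Monotone q := fun i j hij => by
    have : (i : ℝ) ≤ j := by exact_mod_cast hij
    simp only [q]
    gcongr
  have hqstep : ∀ k, q (k + 1) - q k = D := fun k => by
    simp only [q]
    push_cast
    ring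
  have hdisj : Pairwise fun i j => Disjoint (successProb br₀ ⁻¹' Set.Ioo (q i) (q (i + 1)))
      (successProb br₀ ⁻¹' Set.Ioo (q j) (q (j + 1))) := fun i j hij =>
    (hq.pairwise_disjoint_on_Ioo_succ hij).preimage _
  have hsum := sum_integral_visits_le br₀ π T (Finset.range (40 * n))
    (fun k => measurable_successProb br₀ measurableSet_Ioo) hdisj
  -- Pigeonhole: some window gets at most the average share of the visits.
  obtain ⟨k, hk, hvis⟩ := Finset.exists_le_of_sum_le
    (s := Finset.range (40 * n)) (g := fun _ => (T : ℝ) * (1 / (40 * n)))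
    (Finset.nonempty_range_iff.2 (by omega)) (hsum.trans_eq (by
      rw [Finset.sum_const, Finset.card_range, nsmul_eq_mul]
      push_cast
      field_simp))
  have hk' : ((k + 1 : ℕ) : ℝ) ≤ 40 * n := by exact_mod_cast Finset.mem_range.1 hk
  have ha : 1 / 2 ≤ q k := le_add_of_nonneg_right (by positivity)
  have hb : q (k + 1) ≤ 3 / 4 := by
    have h1 : ((k + 1 : ℕ) : ℝ) * D ≤ 40 * n * D := by gcongr
    have h2 : 40 * n * D = 1 / 4 := by
      rw [hD]
      field_simp
      norm_num
    simp only [q]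
    linarith
  refine ⟨gapInstance (q k) (q (k + 1)) (by linarith), fun br => ?_⟩
  have := gap_regret_ge br₀ π T ha (by linarith [hqstep k]) hb br (ε := 1 / (40 * n)) ?_ hvis ?_
  · rw [hqstep] at this
    refine le_trans (le_of_eq ?_) this
    rw [hD]
    field_simp
    norm_num
  · gcongr
    linarith
  · rw [hqstep]
    -- `T ≤ n³` balances `D²` times the `T/(40n)` visits, so `n` cancels from the information bound.
    calc 480 * D ^ 2 * (T * (1 / (40 * n))) ≤ 480 * D ^ 2 * (n ^ 3 * (1 / (40 * n))) := by gcongr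
      _ = 480 / (160 ^ 2 * 40) := by
        rw [hD]
        field_simp
      _ ≤ 1 / 100 := by norm_num

theorem theorem4p2 :
    ∃ C : ℝ, 0 < C ∧
      ∀ (T : ℕ) (π : OnlineContract.Policy),
        ∃ I : OnlineContract.SingleTypeInstance 2,
          ∀ br : OnlineContract.BestResponse I OnlineContract.value01,
            C * (T : ℝ) ^ (2 / 3 : ℝ) ≤ OnlineContract.regret br π T := by
  -- With `n = ⌈T^(1/3)⌉ ≤ 2 T^(1/3)`, the bound `T / (6400 n)` is at least `T^(2/3) / 12800`.
  refine ⟨1 / 12800, by norm_num, fun T π => ?_⟩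
  rcases Nat.eq_zero_or_pos T with rfl | hT
  · refine ⟨OnlineContract.gapInstance 0 0 le_rfl, fun br => ?_⟩
    simp [OnlineContract.regret, Real.zero_rpow]
  · have hT1 : (1 : ℝ) ≤ T := by exact_mod_cast hT
    set r : ℝ := (T : ℝ) ^ (1 / 3 : ℝ) with hr
    have hr1 : 1 ≤ r := Real.one_le_rpow hT1 (by norm_num)
    have hr3 : r ^ 3 = T := by
      rw [hr, ← Real.rpow_natCast, ← Real.rpow_mul (by positivity)]
      norm_num
    have hr2 : (T : ℝ) ^ (2 / 3 : ℝ) = r ^ 2 := by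
      rw [hr, ← Real.rpow_natCast, ← Real.rpow_mul (by positivity)]
      norm_num
    have hn1 : r ≤ ⌈r⌉₊ := Nat.le_ceil r
    have hn2 : (⌈r⌉₊ : ℝ) ≤ 2 * r := by linarith [Nat.ceil_lt_add_one (by positivity : 0 ≤ r)]
    obtain ⟨I, hI⟩ := exists_gapInstance_regret_ge T hT π ⌈r⌉₊ (by
      have : (T : ℝ) ≤ (⌈r⌉₊ : ℝ) ^ 3 := by
        rw [← hr3]
        gcongr
      exact_mod_cast this)
    refine ⟨I, fun br => le_trans ?_ (hI br)⟩
    rw [hr2, ← hr3, le_div_iff₀ (by positivity)]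
    nlinarith [mul_le_mul_of_nonneg_left hn2 (by positivity : 0 ≤ r ^ 2)]
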